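/- Corollary 4. Let $k$ be a (commutative) field, let $G$ be a group, and let $\mathcal{L}$ be a local system of $G$, that is, an upwardly directed collection of subgroups of $G$ whose union is $G$. Let $V$ be a finitary $kG$-module: a $k$-vector space, of arbitrary dimension, on which $G$ acts $k$-linearly in such a way that $(g-1)V$ is finite-dimensional over $k$ for every $g \in G$. Suppose that $V$ is locally completely reducible with respect to $\mathcal{L}$, that is, for every $L \in \mathcal{L}$ the restriction of $V$ to $L$ is a completely reducible $kL$-module. Let $[V,G]$ denote the $kG$-submodule of $V$ spanned over $k$ by all $gv - v$ with $g \in G$ and $v \in V$. Then $[V,G]$ is a completely reducible $kG$-module; that is, every $kG$-submodule $W$ of $[V,G]$ is a direct summand: there is a $kG$-submodule $W'$ of $[V,G]$ with $[V,G] = W \oplus W'$. -/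

import Mathlib

/-- A local system of a group `G`: an upwardly directed collection of subgroups of `G` whose
union is `G`. -/
structure IsLocalSystem {G : Type*} [Group G] (𝓛 : Set (Subgroup G)) : Prop where
  directed : ∀ L₁ ∈ 𝓛, ∀ L₂ ∈ 𝓛, ∃ L ∈ 𝓛, L₁ ≤ L ∧ L₂ ≤ L
  iUnion_eq : ⋃ L ∈ 𝓛, (L : Set G) = Set.univ

namespace Representation

variable {k G V : Type*} [Field k] [Group G] [AddCommGroup V] [Module k V]

/-- A `G`-module `V` over `k` is finitary if `[V, g] = (g - 1)V` is finite-dimensional for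
every `g` in `G`. -/
def IsFinitary (ρ : Representation k G V) : Prop :=
  ∀ g : G, FiniteDimensional k (LinearMap.range (ρ g - LinearMap.id))

/-- The restriction of a `G`-module to a subgroup `L`. -/
def restrictSubgroup (ρ : Representation k G V) (L : Subgroup G) : Representation k L V :=
  ρ.comp L.subtype

/-- `V` is locally completely reducible with respect to `𝓛` if it is completely reducible as an
`L`-module for every `L` in `𝓛`. -/
def IsLocallyCompletelyReducible (ρ : Representation k G V) (𝓛 : Set (Subgroup G)) : Prop :=
  ∀ L ∈ 𝓛, (ρ.restrictSubgroup L).IsSemisimpleRepresentation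

/-- The `G`-submodule `[V, G]` of `V`, spanned over `k` by the elements `g v - v`. -/
def commutatorSub (ρ : Representation k G V) : Subrepresentation ρ where
  toSubmodule := Coinvariants.ker ρ
  apply_mem_toSubmodule h v hv := by
    induction hv using Submodule.span_induction with
    | mem x hx =>
      obtain ⟨⟨g, v⟩, rfl⟩ := hx
      dsimp only
      have e : ρ h (ρ g v - v) = (ρ (h * g) v - v) - (ρ h v - v) := by
        simp [map_mul]
      rw [e]
      exact sub_mem (Coinvariants.sub_mem_ker _ _) (Coinvariants.sub_mem_ker _ _)
    | zero => simp
    | add x y _ _ hx hy => rw [map_add]; exact add_mem hx hy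
    | smul a x _ hx => rw [map_smul]; exact Submodule.smul_mem _ a hx

end Representation

/-! Each `L ∈ 𝓛` has `L`-equivariant projections onto `W`, but they need not agree as `L` grows.
Viewed in `Hom(V, V**) = (V ⊗ V*)*`, they have a limit by linear compactness
(`Module.Dual.exists_forall_apply_eq_of_directed`): a `G`-equivariant `Φ : V → V**`. Finitariness
brings it back to `V`: `Φ` sends `(g - 1)V` into its double annihilator in `V**`, which is `(g -
1)V` itself by finite dimension. So `Φ` projects `[V, G]` onto `W`, and its kernel there is the
complement. -/

open Module TensorProduct

section LinearCompactness

variable {k : Type*} [Field k]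

/-- Linear compactness of dual spaces: for a directed decreasing family of nonempty sets `P i` of
functionals there is a functional which satisfies every affine equation that holds on some
`P i`. -/
theorem Module.Dual.exists_forall_apply_eq_of_directed {ι E : Type*} [Nonempty ι]
    [AddCommGroup E] [Module k E] (P : ι → Set (Dual k E)) (hP : ∀ i, (P i).Nonempty)
    (hdir : Directed (· ⊇ ·) P) :
    ∃ φ : Dual k E, ∀ i x c, (∀ p ∈ P i, p x = c) → φ x = c := by
  -- A pair `(x, c)` encodes the equation `φ x = c`; solvability means that the contradiction `(0,
  -- 1)` is not among the consequences.
  let S : ι → Submodule k (E × k) := fun i =>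
    ⨅ p ∈ P i, LinearMap.ker (p.coprod (-LinearMap.id))
  have hS : ∀ i x c, (x, c) ∈ S i ↔ ∀ p ∈ P i, p x = c := by
    intro i x c
    simp [S, Submodule.mem_iInf, add_neg_eq_zero]
  have hSdir : Directed (· ≤ ·) S := fun i j => by
    obtain ⟨l, hi, hj⟩ := hdir i j
    exact ⟨l, biInf_mono fun _ h => hi h, biInf_mono fun _ h => hj h⟩
  have hnot : ((0 : E), (1 : k)) ∉ ⨆ i, S i := by
    rw [Submodule.mem_iSup_of_directed _ hSdir]
    rintro ⟨i, hi⟩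
    obtain ⟨p, hp⟩ := hP i
    simpa using (hS i 0 1).1 hi p hp
  obtain ⟨F, hF, hker⟩ := Submodule.exists_le_ker_of_notMem hnot
  refine ⟨-(F (0, 1))⁻¹ • (F ∘ₗ LinearMap.inl k E k), fun i x c h => ?_⟩
  have h0 : F (x, c) = 0 := hker (Submodule.mem_iSup_of_mem i ((hS i x c).2 h))
  have h1 : ((x, c) : E × k) = (x, 0) + c • (0, 1) := by simp
  rw [h1, map_add, map_smul, smul_eq_mul] at h0
  rw [LinearMap.smul_apply, LinearMap.comp_apply, LinearMap.inl_apply,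
    eq_neg_of_add_eq_zero_left h0]
  simp only [smul_eq_mul]
  field_simp

/-- A functional on the dual space that vanishes on the annihilator of a finite-dimensional
subspace `F` is evaluation at an element of `F`. -/
theorem Submodule.exists_eval_eq_of_forall_dualAnnihilator {V : Type*} [AddCommGroup V]
    [Module k V] (F : Submodule k V) [FiniteDimensional k F] (ξ : Dual k (Dual k V))
    (hξ : ∀ l ∈ F.dualAnnihilator, ξ l = 0) : ∃ v ∈ F, ξ = Dual.eval k V v := by
  -- Since `l - l ∘ π` kills `F`, `ξ` depends only on `l` restricted to `F`, and `F` is reflexive.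
  obtain ⟨π, hπ⟩ := F.subtype.exists_leftInverse_of_injective F.ker_subtype
  refine ⟨(evalEquiv k F).symm (ξ ∘ₗ π.dualMap), Subtype.property _, ?_⟩
  ext l
  have h1 := apply_evalEquiv_symm_apply (R := k) (M := F) (l ∘ₗ F.subtype) (ξ ∘ₗ π.dualMap)
  have h2 : ξ (l - π.dualMap (l ∘ₗ F.subtype)) = 0 := by
    refine hξ _ ((Submodule.mem_dualAnnihilator _).2 fun x hx => ?_)
    have : π x = ⟨x, hx⟩ := LinearMap.congr_fun hπ ⟨x, hx⟩
    simp [this]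
  rw [map_sub, sub_eq_zero] at h2
  rw [h2]
  exact h1.symm

end LinearCompactness

namespace Representation

variable {k G V : Type*} [Field k] [Group G] [AddCommGroup V] [Module k V]

/-- The projections onto a subrepresentation `W` that commute with the action of a subgroup `L`. -/
def equivariantProjections {ρ : Representation k G V} (W : Subrepresentation ρ) (L : Subgroup G) :
    Set (V →ₗ[k] V) :=
  {p | (∀ w ∈ W.toSubmodule, p w = w) ∧ (∀ v, p v ∈ W.toSubmodule) ∧
    ∀ g ∈ L, ∀ v, p (ρ g v) = ρ g (p v)}

theorem equivariantProjections_nonempty {ρ : Representation k G V} (W : Subrepresentation ρ)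
    (L : Subgroup G) (hL : (ρ.restrictSubgroup L).IsSemisimpleRepresentation) :
    (equivariantProjections W L).Nonempty := by
  let WL : Subrepresentation (ρ.restrictSubgroup L) :=
    ⟨W.toSubmodule, fun g _ hv => W.apply_mem_toSubmodule g hv⟩
  obtain ⟨C, hC⟩ := hL.exists_isCompl WL
  have h : IsCompl W.toSubmodule C.toSubmodule := by
    refine IsCompl.of_eq ?_ ?_
    · exact congrArg Subrepresentation.toSubmodule hC.inf_eq_bot
    · exact congrArg Subrepresentation.toSubmodule hC.sup_eq_top
  have hW : ∀ w ∈ W.toSubmodule, W.toSubmodule.projection C.toSubmodule h w = w := fun w hw =>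
    Submodule.projection_apply_left h ⟨w, hw⟩
  have hC0 : ∀ c ∈ C.toSubmodule, W.toSubmodule.projection C.toSubmodule h c = 0 := fun c hc =>
    (Submodule.projection_apply_eq_zero_iff h).2 hc
  refine ⟨_, hW, fun v => Submodule.projection_apply_mem h v, fun g hg v => ?_⟩
  obtain ⟨w, hw, c, hc, rfl⟩ := Submodule.mem_sup.1 (h.sup_eq_top ▸ Submodule.mem_top : v ∈ _)
  have hgc : ρ g c ∈ C.toSubmodule := C.apply_mem_toSubmodule ⟨g, hg⟩ hc
  simp only [map_add, hW w hw, hC0 c hc, hC0 _ hgc, hW _ (W.apply_mem_toSubmodule g hw), map_zero]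

/-- A functional version of a `G`-equivariant projection onto `W`, obtained from equivariant
projections for the members of a local system by linear compactness. -/
theorem exists_dual_dual_projection (ρ : Representation k G V) {𝓛 : Set (Subgroup G)}
    (h𝓛 : IsLocalSystem 𝓛) (hlcr : ρ.IsLocallyCompletelyReducible 𝓛) (W : Subrepresentation ρ) :
    ∃ Φ : V →ₗ[k] Dual k (Dual k V),
      (∀ w ∈ W.toSubmodule, Φ w = Dual.eval k V w) ∧
      (∀ v, ∀ l ∈ W.toSubmodule.dualAnnihilator, Φ v l = 0) ∧
      (∀ g v l, Φ (ρ g v) l = Φ v (l ∘ₗ ρ g)) ∧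
      ∀ g v, ∀ l ∈ (LinearMap.range (ρ g - LinearMap.id)).dualAnnihilator,
        Φ (ρ g v - v) l = 0 := by
  have hmem : ∀ g : G, ∃ L : 𝓛, g ∈ L.1 := fun g => by
    have : g ∈ ⋃ L ∈ 𝓛, (L : Set G) := h𝓛.iUnion_eq ▸ Set.mem_univ g
    simpa using this
  obtain ⟨L₀, -⟩ := hmem 1
  have : Nonempty 𝓛 := ⟨L₀⟩
  let θ : (V →ₗ[k] V) → Dual k (V ⊗[k] Dual k V) := fun p =>
    TensorProduct.lift (Dual.eval k V ∘ₗ p)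
  have hθ : ∀ p v l, θ p (v ⊗ₜ l) = l (p v) := fun p v l => by simp [θ]
  obtain ⟨φ, hφ⟩ := Module.Dual.exists_forall_apply_eq_of_directed
    (fun L : 𝓛 => θ '' equivariantProjections W L.1)
    (fun L => (equivariantProjections_nonempty W L.1 (hlcr L.1 L.2)).image θ)
    (fun L₁ L₂ => by
      obtain ⟨L, hL, h₁, h₂⟩ := h𝓛.directed L₁.1 L₁.2 L₂.1 L₂.2
      exact ⟨⟨L, hL⟩,
        Set.image_mono fun p hp => ⟨hp.1, hp.2.1, fun g hg => hp.2.2 g (h₁ hg)⟩,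
        Set.image_mono fun p hp => ⟨hp.1, hp.2.1, fun g hg => hp.2.2 g (h₂ hg)⟩⟩)
  have key : ∀ (L : 𝓛) x c, (∀ p ∈ equivariantProjections W L.1, θ p x = c) → φ x = c :=
    fun L x c h => hφ L x c (by rintro _ ⟨p, hp, rfl⟩; exact h p hp)
  refine ⟨TensorProduct.curry φ, fun w hw => ?_, fun v l hl => ?_, fun g v l => ?_,
    fun g v l hl => ?_⟩
  · ext l
    refine key L₀ _ _ fun p hp => ?_
    rw [mk_apply, hθ, hp.1 w hw, Dual.eval_apply]
  · refine key L₀ _ _ fun p hp => ?_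
    rw [mk_apply, hθ]
    exact (Submodule.mem_dualAnnihilator _).1 hl _ (hp.2.1 v)
  · obtain ⟨L, hg⟩ := hmem g
    have := key L (ρ g v ⊗ₜ l - v ⊗ₜ (l ∘ₗ ρ g)) 0 fun p hp => by
      rw [map_sub, hθ, hθ, hp.2.2 g hg, LinearMap.comp_apply, sub_self]
    rwa [map_sub, sub_eq_zero] at this
  · obtain ⟨L, hg⟩ := hmem g
    refine key L _ _ fun p hp => ?_
    rw [mk_apply, hθ, map_sub, hp.2.2 g hg]
    -- Equivariance gives `p ((g - 1) v) = (g - 1) (p v)`.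
    exact (Submodule.mem_dualAnnihilator _).1 hl _ ⟨p v, by simp⟩

theorem exists_complement_in_commutatorSub (ρ : Representation k G V) {𝓛 : Set (Subgroup G)}
    (h𝓛 : IsLocalSystem 𝓛) (hfin : ρ.IsFinitary) (hlcr : ρ.IsLocallyCompletelyReducible 𝓛)
    (W : Subrepresentation ρ) (hW : W ≤ ρ.commutatorSub) :
    ∃ W' : Subrepresentation ρ, W ⊔ W' = ρ.commutatorSub ∧ W ⊓ W' = ⊥ := by
  obtain ⟨Φ, hΦW, hΦann, hΦeq, hΦfin⟩ := ρ.exists_dual_dual_projection h𝓛 hlcr W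
  have heval : ∀ u ∈ Coinvariants.ker ρ, ∃ v, Φ u = Dual.eval k V v := by
    intro u hu
    induction hu using Submodule.span_induction with
    | mem x hx =>
      obtain ⟨⟨g, v⟩, rfl⟩ := hx
      have := hfin g
      obtain ⟨y, -, hy⟩ := Submodule.exists_eval_eq_of_forall_dualAnnihilator
        (LinearMap.range (ρ g - LinearMap.id)) (Φ (ρ g v - v)) (hΦfin g v)
      exact ⟨y, hy⟩
    | zero => exact ⟨0, by simp⟩
    | add x y _ _ hx hy =>
      obtain ⟨a, ha⟩ := hx
      obtain ⟨b, hb⟩ := hy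
      exact ⟨a + b, by rw [map_add, map_add, ha, hb]⟩
    | smul c x _ hx =>
      obtain ⟨a, ha⟩ := hx
      exact ⟨c • a, by rw [map_smul, map_smul, ha]⟩
  let W' : Subrepresentation ρ :=
    { toSubmodule := Coinvariants.ker ρ ⊓ LinearMap.ker Φ
      apply_mem_toSubmodule := fun g v hv =>
        ⟨ρ.commutatorSub.apply_mem_toSubmodule g hv.1, LinearMap.mem_ker.2 <| by
          ext l
          rw [hΦeq, LinearMap.mem_ker.1 hv.2]
          rfl⟩ }
  refine ⟨W', le_antisymm (sup_le hW fun x hx => hx.1) fun u hu => ?_, ?_⟩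
  · obtain ⟨v, hv⟩ := heval u hu
    -- Over a field, a vector killed by the whole annihilator of `W` lies in `W`, whatever the
    -- dimension.
    have hvW : v ∈ W.toSubmodule :=
      (Subspace.forall_mem_dualAnnihilator_apply_eq_zero_iff _ v).1 fun l hl => by
        rw [← Dual.eval_apply k V v l, ← hv]
        exact hΦann u l hl
    refine Submodule.mem_sup.2 ⟨v, hvW, u - v, ⟨sub_mem hu (hW hvW), ?_⟩, by abel⟩
    rw [SetLike.mem_coe, LinearMap.mem_ker, map_sub, hΦW v hvW, hv, sub_self]
  · refine Subrepresentation.toSubmodule_injective ((Submodule.eq_bot_iff _).2 fun w hw => ?_)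
    have h0 : Dual.eval k V w = 0 := (hΦW w hw.1).symm.trans (LinearMap.mem_ker.1 hw.2.2)
    exact (forall_dual_apply_eq_zero_iff k w).1 fun l => LinearMap.congr_fun h0 l

/-- A subrepresentation is semisimple if each smaller subrepresentation has a relative
complement in it. -/
theorem isSemisimpleRepresentation_toRepresentation {ρ : Representation k G V}
    (U : Subrepresentation ρ)
    (h : ∀ W ≤ U, ∃ W' : Subrepresentation ρ, W ⊔ W' = U ∧ W ⊓ W' = ⊥) :
    U.toRepresentation.IsSemisimpleRepresentation := by
  refine ⟨fun W => ?_⟩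
  let WV : Subrepresentation ρ :=
    { toSubmodule := W.toSubmodule.map U.toSubmodule.subtype
      apply_mem_toSubmodule := by
        rintro g _ ⟨x, hx, rfl⟩
        exact ⟨_, W.apply_mem_toSubmodule g hx, rfl⟩ }
  have hWV : WV ≤ U := by
    rintro _ ⟨x, -, rfl⟩
    exact x.2
  obtain ⟨C, hsup, hinf⟩ := h WV hWV
  have hsup' : WV.toSubmodule ⊔ C.toSubmodule = U.toSubmodule :=
    congrArg Subrepresentation.toSubmodule hsup
  have hinf' : WV.toSubmodule ⊓ C.toSubmodule = ⊥ :=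
    congrArg Subrepresentation.toSubmodule hinf
  refine ⟨⟨C.toSubmodule.comap U.toSubmodule.subtype,
    fun g v hv => C.apply_mem_toSubmodule g hv⟩, IsCompl.of_eq ?_ ?_⟩
  · refine Subrepresentation.toSubmodule_injective ((Submodule.eq_bot_iff _).2 fun w hw => ?_)
    exact Subtype.ext ((Submodule.eq_bot_iff _).1 hinf' w ⟨⟨w, hw.1, rfl⟩, hw.2⟩)
  · refine Subrepresentation.toSubmodule_injective ((Submodule.eq_top_iff').2 fun u => ?_)
    obtain ⟨_, ⟨x, hx, rfl⟩, c, hc, hxc⟩ := Submodule.mem_sup.1 (hsup'.ge u.2)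
    have hcU : c ∈ U.toSubmodule := hsup'.le (Submodule.mem_sup_right hc)
    exact Submodule.mem_sup.2 ⟨x, hx, ⟨c, hcU⟩, hc, Subtype.ext hxc⟩

end Representation

theorem corollary4 {k G V : Type*} [Field k] [Group G] [AddCommGroup V] [Module k V]
    (ρ : Representation k G V) (𝓛 : Set (Subgroup G)) (h𝓛 : IsLocalSystem 𝓛)
    (hfin : ρ.IsFinitary) (hlcr : ρ.IsLocallyCompletelyReducible 𝓛) :
    ρ.commutatorSub.toRepresentation.IsSemisimpleRepresentation ∧
      ∀ W : Subrepresentation ρ, W ≤ ρ.commutatorSub →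
        ∃ W' : Subrepresentation ρ, W ⊔ W' = ρ.commutatorSub ∧ W ⊓ W' = ⊥ := by
  have h := ρ.exists_complement_in_commutatorSub h𝓛 hfin hlcr
  exact ⟨Representation.isSemisimpleRepresentation_toRepresentation _ h, h⟩
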